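/- Let $\mathcal G$ be a finite directed network with node set $\mathcal V$ and link set $\mathcal E$, in which each link $e$ runs from an initial node to a distinct terminal node (parallel links are allowed). Assume that $\mathcal G$ is strongly connected: for any two distinct nodes $v,w$ there is a path from $v$ to $w$ that traverses all of its links in their direction. Let $o\neq d$ be two nodes (origin and destination). Let $A\in\mathbb R^{(\mathcal V\setminus\{d\})\times\mathcal E}$ be the incidence matrix without the row of $d$: $A_{v,e}=-1$ if $v$ is the initial node of $e$, $A_{v,e}=+1$ if $v$ is the terminal node of $e$, and $A_{v,e}=0$ otherwise. Let $b\in\mathbb R^{\mathcal V\setminus\{d\}}$ have $b_o=-1$ and $b_v=0$ for $v\ne o$. Let $c\in\mathbb R^{\mathcal E}$ be arbitrary. For each link $e$ let $h_e:\mathbb R\to(-\infty,\infty]$ be a convex function with effective domain $\{h_e<\infty\}=[0,\infty)$ that is continuous relative to $[0,\infty)$, strictly convex on $[0,\infty)$, and satisfies $\lim_{\xi\to\infty}h_e(\xi)/\xi=\infty$. Put $H(x)=\sum_{e\in\mathcal E}h_e(x_e)$ for $x\in\mathbb R^{\mathcal E}$, and let $f^*(y)=\sup_x\{\langle x,y\rangle-f(x)\}$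 denote the convex conjugate. Define the primal value $$p=\inf\{\langle c,x\rangle+H(x): x\in\mathbb R^{\mathcal E},\ Ax=b\},$$ the dual function $$g(u)=\inf_{x\in\mathbb R^{\mathcal E}}\{\langle c,x\rangle+H(x)+\langle u,b-Ax\rangle\},\qquad u\in\mathbb R^{\mathcal V\setminus\{d\}},$$ the dual value $p^*=\sup_u g(u)$, and the set $\widehat U=\operatorname{argmax}_u g(u)$ of optimal potentials. Then the dual value is attained, $p$ is finite, and $p^*=p$. The set $\widehat U$ is non-empty and closed. There is exactly one optimal flow $\widehat x$, that is, exactly one minimizer in the problem defining $p$. For every $\widehat u\in\widehat U$, the conjugate $H^*$ is finite near $A^\top\widehat u-c$ and differentiable there, and $$\widehat x=\nabla H^*(A^\top\widehat u-c);$$ link by link, for every $e\in\mathcal E$, $h_e^*$ is finite near $(A^\top\widehat u-c)_e$ and differentiable there, and $\widehat x_e=\nabla h_e^*\big((A^\top\widehat u-c)_e\big)$. -/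

import Mathlib

open Set Filter Topology

noncomputable section

namespace PURC

/-! ### Convex analysis for extended real-valued functions -/

/-- The effective domain of `f`. -/
def effectiveDomain {F : Type*} (f : F → EReal) : Set F := {x | f x < ⊤}

/-- The epigraph of `f`. -/
def epigraph {F : Type*} (f : F → EReal) : Set (F × ℝ) := {p | f p.1 ≤ (p.2 : EReal)}

/-- The convex conjugate `f*(y) = sup_x (⟨x, y⟩ - f x)`. -/
def conjugate {F : Type*} [NormedAddCommGroup F] [InnerProductSpace ℝ F]
    (f : F → EReal) (y : F) : EReal :=
  ⨆ x : F, ((inner ℝ x y : ℝ) : EReal) - f x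

/-- The extended real-valued function `f` is finite near `x` and differentiable at `x`,
with gradient `f'`. -/
def HasFiniteGradientAt {F : Type*} [NormedAddCommGroup F] [InnerProductSpace ℝ F]
    [CompleteSpace F] (f : F → EReal) (f' x : F) : Prop :=
  (∀ᶠ z in 𝓝 x, f z ≠ ⊥ ∧ f z ≠ ⊤) ∧ HasGradientAt (fun z => (f z).toReal) f' x

/-! ### Traffic networks -/

/-- A directed network: every link has an initial and a terminal node, which are distinct.
Parallel links are allowed. -/
structure Network (V E : Type*) where
  /-- the initial node of a link -/
  initial : E → V
  /-- the terminal node of a link -/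
  terminal : E → V
  initial_ne_terminal : ∀ e, initial e ≠ terminal e

namespace Network

variable {V E : Type*}

/-- `G.PositivePath v w`: there is a path from `v` to `w` all of whose links are traversed
in the direction of traffic. -/
inductive PositivePath (G : Network V E) (v : V) : V → Prop
  | nil : PositivePath G v v
  | snoc (e : E) : PositivePath G v (G.initial e) → PositivePath G v (G.terminal e)

/-- Every pair of distinct nodes is connected by a positive path. -/
def StronglyConnected (G : Network V E) : Prop :=
  ∀ v w : V, v ≠ w → G.PositivePath v w

variable [DecidableEq V]

/-- The full node-link incidence matrix. -/
def incidence (G : Network V E) : Matrix V E ℝ := fun v e =>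
  if v = G.initial e then -1 else if v = G.terminal e then 1 else 0

/-- The incidence matrix without the row of the destination `d`. -/
def reducedIncidence (G : Network V E) (d : V) : Matrix {v : V // v ≠ d} E ℝ :=
  fun v e => G.incidence v.1 e

end Network

/-- The full demand vector of a trip from `o` to `d`. -/
def demand {V : Type*} [DecidableEq V] (o d : V) : V → ℝ := fun v =>
  if v = o then -1 else if v = d then 1 else 0

/-- The demand vector without the entry of the destination `d`. -/
def reducedDemand {V : Type*} [DecidableEq V] (o d : V) : EuclideanSpace ℝ {v : V // v ≠ d} :=
  WithLp.toLp 2 fun v => demand o d v.1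

/-! ### Traveler preferences -/

/-- The condition on link perturbation functions: a convex function into `(-∞, ∞]` with
effective domain `[0, ∞)`, continuous relative to `[0, ∞)`, strictly convex on `[0, ∞)`, and
superlinear at infinity. -/
structure IsLinkPerturbation (h : ℝ → EReal) : Prop where
  ne_bot : ∀ ξ, h ξ ≠ ⊥
  convex : Convex ℝ (epigraph h)
  domain_eq : effectiveDomain h = Ici 0
  continuousOn : ContinuousOn h (Ici 0)
  strictConvex : ∀ ξ ∈ Ici (0 : ℝ), ∀ ζ ∈ Ici (0 : ℝ), ξ ≠ ζ → ∀ t : ℝ, 0 < t → t < 1 →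
    h ((1 - t) * ξ + t * ζ) < ((1 - t : ℝ) : EReal) * h ξ + (t : EReal) * h ζ
  superlinear : Tendsto (fun ξ : ℝ => h ξ / (ξ : EReal)) atTop (𝓝 ⊤)

section Problem

variable {V E : Type*} [Fintype V] [DecidableEq V] [Fintype E]

/-- The separable perturbation function `H(x) = ∑ₑ hₑ(xₑ)`. -/
def perturbation (h : E → ℝ → EReal) (x : EuclideanSpace ℝ E) : EReal :=
  ∑ e, h e (x e)

/-- The traveler's cost `⟨c, x⟩ + H(x)`. -/
def cost (h : E → ℝ → EReal) (c x : EuclideanSpace ℝ E) : EReal :=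
  ((inner ℝ c x : ℝ) : EReal) + perturbation h x

/-- The vector `A x`, for the reduced incidence matrix `A`. -/
def netInflow (G : Network V E) (d : V) (x : EuclideanSpace ℝ E) :
    EuclideanSpace ℝ {v : V // v ≠ d} :=
  WithLp.toLp 2 ((G.reducedIncidence d).mulVec x.ofLp)

/-- The vector of tensions `Aᵀ u`, for the reduced incidence matrix `A`. -/
def tension (G : Network V E) (d : V) (u : EuclideanSpace ℝ {v : V // v ≠ d}) :
    EuclideanSpace ℝ E :=
  WithLp.toLp 2 ((G.reducedIncidence d).transpose.mulVec u.ofLp)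

/-- The flows with `A x = b`. -/
def conservingFlows (G : Network V E) (o d : V) : Set (EuclideanSpace ℝ E) :=
  {x | netInflow G d x = reducedDemand o d}

/-- The optimal primal value `p`. -/
def primalValue (G : Network V E) (h : E → ℝ → EReal) (o d : V) (c : EuclideanSpace ℝ E) :
    EReal :=
  ⨅ x ∈ conservingFlows G o d, cost h c x

/-- The set of optimal flows. -/
def optimalFlows (G : Network V E) (h : E → ℝ → EReal) (o d : V) (c : EuclideanSpace ℝ E) :
    Set (EuclideanSpace ℝ E) :=
  {x | x ∈ conservingFlows G o d ∧ IsMinOn (cost h c) (conservingFlows G o d) x}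

/-- The Lagrangian `L(u, x) = ⟨c, x⟩ + H(x) + ⟨u, b - A x⟩`. -/
def lagrangian (G : Network V E) (h : E → ℝ → EReal) (o d : V) (c : EuclideanSpace ℝ E)
    (u : EuclideanSpace ℝ {v : V // v ≠ d}) (x : EuclideanSpace ℝ E) : EReal :=
  cost h c x + ((inner ℝ u (reducedDemand o d - netInflow G d x) : ℝ) : EReal)

/-- The dual function `g(u) = inf_x L(u, x)`. -/
def dualFunction (G : Network V E) (h : E → ℝ → EReal) (o d : V) (c : EuclideanSpace ℝ E)
    (u : EuclideanSpace ℝ {v : V // v ≠ d}) : EReal :=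
  ⨅ x : EuclideanSpace ℝ E, lagrangian G h o d c u x

/-- The optimal dual value `p*`. -/
def dualValue (G : Network V E) (h : E → ℝ → EReal) (o d : V) (c : EuclideanSpace ℝ E) :
    EReal :=
  ⨆ u : EuclideanSpace ℝ {v : V // v ≠ d}, dualFunction G h o d c u

/-- The set of optimal potentials. -/
def optimalPotentials (G : Network V E) (h : E → ℝ → EReal) (o d : V)
    (c : EuclideanSpace ℝ E) : Set (EuclideanSpace ℝ {v : V // v ≠ d}) :=
  {u | IsMaxOn (dualFunction G h o d c) univ u}

end Problem

end PURC

end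

/-! On each link, superlinearity and strict convexity give `ξ * y - h ξ` exactly one maximizer
`linkFlow y` over `ξ ≥ 0`. It is continuous in `y`, so the conjugate is real-valued and
differentiable with derivative `linkFlow`. Summing over links gives the same for `H*`, with gradient
`flow`.

Hence `g u = ⟨u, b⟩ - H*(Aᵀu - c)` is differentiable, and its gradient is the residual `b - A x` of
the flow `x = ∇H*(Aᵀu - c)` (`hasFDerivAt_realDual`). At a maximizer of `g` the residual vanishes,
so `x` is feasible and costs exactly `g u`; by weak duality it is optimal and there is no gap.
Strict convexity makes the optimal flow unique, so all optimal potentials generate the same one.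

A maximizer of `g` exists by coercivity, where strong connectivity enters twice: it provides a
feasible flow with all entries at least 1, whence `g u ≤ M - ‖Aᵀu‖`
(`exists_realDual_le_sub_norm_tension`), and it makes `Aᵀ` injective (`tensionLin_injective`). -/

noncomputable section

namespace PURC

/-! ### Link perturbation functions -/

namespace IsLinkPerturbation

variable {h : ℝ → EReal}

lemma lt_top_iff (hh : IsLinkPerturbation h) {ξ : ℝ} : h ξ < ⊤ ↔ 0 ≤ ξ := by
  have : ξ ∈ effectiveDomain h ↔ ξ ∈ Ici (0 : ℝ) := by rw [hh.domain_eq]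
  exact this

lemma eq_top (hh : IsLinkPerturbation h) {ξ : ℝ} (hξ : ξ < 0) : h ξ = ⊤ := by
  by_contra hne
  exact absurd (hh.lt_top_iff.1 (lt_top_iff_ne_top.2 hne)) (not_le.2 hξ)

lemma coe_toReal (hh : IsLinkPerturbation h) {ξ : ℝ} (hξ : 0 ≤ ξ) :
    ((h ξ).toReal : EReal) = h ξ :=
  EReal.coe_toReal (hh.lt_top_iff.2 hξ).ne (hh.ne_bot ξ)

lemma continuousOn_toReal (hh : IsLinkPerturbation h) :
    ContinuousOn (fun ξ => (h ξ).toReal) (Ici 0) := by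
  intro ξ hξ
  exact (EReal.tendsto_toReal (hh.lt_top_iff.2 hξ).ne (hh.ne_bot ξ)).comp (hh.continuousOn ξ hξ)

lemma strictConvexOn_toReal (hh : IsLinkPerturbation h) :
    StrictConvexOn ℝ (Ici 0) (fun ξ => (h ξ).toReal) := by
  refine ⟨convex_Ici 0, fun ξ hξ ζ hζ hne a b ha hb hab => ?_⟩
  obtain rfl : a = 1 - b := by linarith
  have hlt := hh.strictConvex ξ hξ ζ hζ hne b hb (by linarith)
  have hmem : 0 ≤ (1 - b) * ξ + b * ζ :=
    add_nonneg (mul_nonneg ha.le hξ) (mul_nonneg hb.le hζ)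
  rw [← hh.coe_toReal hξ, ← hh.coe_toReal hζ, ← hh.coe_toReal hmem] at hlt
  exact_mod_cast hlt

lemma exists_mul_le_toReal (hh : IsLinkPerturbation h) (K : ℝ) :
    ∃ R : ℝ, ∀ ξ, R ≤ ξ → K * ξ ≤ (h ξ).toReal := by
  have hev := (EReal.tendsto_nhds_top_iff_real.1 hh.superlinear K).and (eventually_gt_atTop 0)
  obtain ⟨R, hR⟩ := eventually_atTop.1 hev
  refine ⟨R, fun ξ hξ => ?_⟩
  obtain ⟨h1, h2⟩ := hR ξ hξ
  rw [← hh.coe_toReal h2.le, ← EReal.coe_div] at h1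
  have h3 : K < (h ξ).toReal / ξ := by exact_mod_cast h1
  exact ((lt_div_iff₀ h2).1 h3).le

lemma exists_maximizer (hh : IsLinkPerturbation h) (y : ℝ) :
    ∃ ξ : ℝ, 0 ≤ ξ ∧ ∀ ζ : ℝ, 0 ≤ ζ → ζ * y - (h ζ).toReal ≤ ξ * y - (h ξ).toReal := by
  -- With slope `y + 1`, the objective is at most `-ζ` for `ζ ≥ R`. Once also `ζ ≥ h 0`, this is no
  -- more than its value `-h 0` at zero, so a compact interval suffices.
  obtain ⟨R, hR⟩ := hh.exists_mul_le_toReal (y + 1)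
  set S := max (max R (h 0).toReal) 0
  have hS : 0 ≤ S := le_max_right _ _
  have hcont : ContinuousOn (fun ζ => ζ * y - (h ζ).toReal) (Icc 0 S) :=
    ((continuous_id.mul continuous_const).continuousOn).sub
      (hh.continuousOn_toReal.mono fun ζ hζ => hζ.1)
  obtain ⟨ξ, hξ, hmax⟩ := isCompact_Icc.exists_isMaxOn (nonempty_Icc.2 hS) hcont
  refine ⟨ξ, hξ.1, fun ζ hζ => ?_⟩
  rcases le_total ζ S with hle | hle
  · exact hmax ⟨hζ, hle⟩
  · have h0 := hmax (left_mem_Icc.2 hS)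
    simp only [mem_ofPred_eq] at h0
    have h1 := hR ζ ((le_max_left _ _).trans ((le_max_left _ _).trans hle))
    have h2 : (h 0).toReal ≤ ζ := (le_max_right _ _).trans ((le_max_left _ _).trans hle)
    linarith

/-- The maximizer of `ξ y - h ξ`. -/
def linkFlow (hh : IsLinkPerturbation h) (y : ℝ) : ℝ := (hh.exists_maximizer y).choose

lemma linkFlow_nonneg (hh : IsLinkPerturbation h) (y : ℝ) : 0 ≤ hh.linkFlow y :=
  (hh.exists_maximizer y).choose_spec.1

/-- The real-valued convex conjugate of a link perturbation function. -/
def realConjugate (hh : IsLinkPerturbation h) (y : ℝ) : ℝ :=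
  hh.linkFlow y * y - (h (hh.linkFlow y)).toReal

lemma sub_le_realConjugate (hh : IsLinkPerturbation h) (y : ℝ) {ζ : ℝ} (hζ : 0 ≤ ζ) :
    ζ * y - (h ζ).toReal ≤ hh.realConjugate y :=
  (hh.exists_maximizer y).choose_spec.2 ζ hζ

/-- If `ζ` also attained the maximum, strict convexity would put the midpoint of the two maximizers
above it. -/
lemma sub_lt_realConjugate (hh : IsLinkPerturbation h) (y : ℝ) {ζ : ℝ} (hζ : 0 ≤ ζ)
    (hne : ζ ≠ hh.linkFlow y) : ζ * y - (h ζ).toReal < hh.realConjugate y := by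
  have hlt := hh.strictConvexOn_toReal.2 hζ (hh.linkFlow_nonneg y) hne
    (by norm_num : (0 : ℝ) < 1 / 2) (by norm_num : (0 : ℝ) < 1 / 2) (by norm_num)
  have hmid := hh.sub_le_realConjugate y (ζ := (1 / 2 : ℝ) • ζ + (1 / 2 : ℝ) • hh.linkFlow y)
    (by have := hh.linkFlow_nonneg y; simp only [smul_eq_mul]; positivity)
  simp only [smul_eq_mul, realConjugate] at *
  linarith

lemma conjugate_eq (hh : IsLinkPerturbation h) (y : ℝ) :
    conjugate h y = (hh.realConjugate y : EReal) := by
  apply le_antisymm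
  · refine iSup_le fun ζ => ?_
    rcases lt_or_ge ζ 0 with hζ | hζ
    · simp [hh.eq_top hζ]
    · rw [← hh.coe_toReal hζ]
      have := hh.sub_le_realConjugate y hζ
      have hi : inner ℝ ζ y = ζ * y := by simp [mul_comm]
      rw [hi]
      exact_mod_cast this
  · refine le_iSup_of_le (hh.linkFlow y) ?_
    have hi : inner ℝ (hh.linkFlow y) y = hh.linkFlow y * y := by simp [mul_comm]
    rw [← hh.coe_toReal (hh.linkFlow_nonneg y), hi]
    exact_mod_cast le_rfl

lemma realConjugate_add_le (hh : IsLinkPerturbation h) (y z : ℝ) :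
    hh.realConjugate y + hh.linkFlow y * (z - y) ≤ hh.realConjugate z := by
  have := hh.sub_le_realConjugate z (hh.linkFlow_nonneg y)
  simp only [realConjugate] at *
  linarith

/-- If `z` prefers `a` to `b`, then `b` does not lie between `a` and the maximizer for `z`. -/
lemma notMem_segment (hh : IsLinkPerturbation h) {z a b : ℝ} (ha : 0 ≤ a)
    (hlt : b * z - (h b).toReal < a * z - (h a).toReal) : b ∉ segment ℝ a (hh.linkFlow z) := by
  rintro ⟨s, t, hs, ht, hst, rfl⟩
  -- The objective for `z` is concave and maximal at `linkFlow z`, so on the segment it never drops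
  -- below its value at `a`.
  have hc := hh.strictConvexOn_toReal.convexOn.2 ha (hh.linkFlow_nonneg z) hs ht hst
  have hle := hh.sub_le_realConjugate z ha
  simp only [smul_eq_mul, realConjugate] at *
  obtain rfl : s = 1 - t := by linarith
  nlinarith [mul_le_mul_of_nonneg_left hle ht]

/-- The strict preference for `linkFlow y` over `b` persists for `z` near `y`, since with both
points fixed the objectives are continuous in `z`. -/
lemma eventually_notMem_segment (hh : IsLinkPerturbation h) (y : ℝ) {b : ℝ} (hb : 0 ≤ b)
    (hne : b ≠ hh.linkFlow y) : ∀ᶠ z in 𝓝 y,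
      b ∉ segment ℝ (hh.linkFlow y) (hh.linkFlow z) := by
  have hlt := hh.sub_lt_realConjugate y hb hne
  have hev : ∀ᶠ z in 𝓝 y, b * z - (h b).toReal <
      hh.linkFlow y * z - (h (hh.linkFlow y)).toReal :=
    ContinuousAt.eventually_lt (by fun_prop) (by fun_prop) hlt
  filter_upwards [hev] with z hz
  exact hh.notMem_segment (hh.linkFlow_nonneg y) hz

/-- If `linkFlow z` reached or crossed a threshold `b ≠ linkFlow y`, then `b` would lie in the
segment excluded for `z` near `y`. -/
lemma continuous_linkFlow (hh : IsLinkPerturbation h) : Continuous hh.linkFlow := by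
  rw [continuous_iff_continuousAt]
  intro y
  refine tendsto_order.2 ⟨fun b hb => ?_, fun b hb => ?_⟩
  · rcases lt_or_ge b 0 with h0 | h0
    · exact Eventually.of_forall fun z => h0.trans_le (hh.linkFlow_nonneg z)
    · filter_upwards [hh.eventually_notMem_segment y h0 hb.ne] with z hz
      by_contra! hle
      exact hz (by rw [segment_symm, segment_eq_Icc (hle.trans hb.le)]; exact ⟨hle, hb.le⟩)
  · filter_upwards [hh.eventually_notMem_segment y ((hh.linkFlow_nonneg y).trans hb.le) hb.ne'] with z hz
    by_contra! hle
    exact hz (by rw [segment_eq_Icc (hb.le.trans hle)]; exact ⟨hb.le, hle⟩)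

/-- The subgradient inequalities at `y` and at `z` trap the remainder between 0 and `(linkFlow z -
linkFlow y) * (z - y)`, which is small by continuity. -/
lemma hasDerivAt_realConjugate (hh : IsLinkPerturbation h) (y : ℝ) :
    HasDerivAt hh.realConjugate (hh.linkFlow y) y := by
  rw [hasDerivAt_iff_isLittleO, Asymptotics.isLittleO_iff]
  intro ε hε
  filter_upwards [(Metric.tendsto_nhds.1 (hh.continuous_linkFlow.tendsto y)) ε hε] with z hz
  have h1 := hh.realConjugate_add_le y z
  have h2 := hh.realConjugate_add_le z y
  rw [Real.dist_eq] at hz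
  rw [Real.norm_eq_abs, Real.norm_eq_abs, smul_eq_mul, abs_of_nonneg (by linarith)]
  calc hh.realConjugate z - hh.realConjugate y - (z - y) * hh.linkFlow y
      ≤ (hh.linkFlow z - hh.linkFlow y) * (z - y) := by linarith
    _ ≤ |hh.linkFlow z - hh.linkFlow y| * |z - y| := by rw [← abs_mul]; exact le_abs_self _
    _ ≤ ε * |z - y| := by gcongr

lemma hasFiniteGradientAt_conjugate (hh : IsLinkPerturbation h) (y : ℝ) :
    HasFiniteGradientAt (conjugate h) (hh.linkFlow y) y := by
  refine ⟨Eventually.of_forall fun z => ?_, ?_⟩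
  · rw [hh.conjugate_eq]
    exact ⟨EReal.coe_ne_bot _, EReal.coe_ne_top _⟩
  · simp only [hh.conjugate_eq, EReal.toReal_coe]
    exact (hh.hasDerivAt_realConjugate y).hasGradientAt'

end IsLinkPerturbation

lemma ereal_coe_sum {ι : Type*} (s : Finset ι) (f : ι → ℝ) :
    ((∑ i ∈ s, f i : ℝ) : EReal) = ∑ i ∈ s, (f i : EReal) := by
  classical
  induction s using Finset.induction_on with
  | empty => simp
  | insert i s hi ih => rw [Finset.sum_insert hi, Finset.sum_insert hi, EReal.coe_add, ih]

lemma ereal_sum_ne_bot {ι : Type*} (s : Finset ι) (f : ι → EReal) (hf : ∀ i ∈ s, f i ≠ ⊥) :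
    ∑ i ∈ s, f i ≠ ⊥ := by
  classical
  induction s using Finset.induction_on with
  | empty => simp
  | insert i s hi ih =>
    rw [Finset.sum_insert hi, Ne, EReal.add_eq_bot_iff, not_or]
    exact ⟨hf i (by simp), ih fun j hj => hf j (by simp [hj])⟩

/-! ### Separable perturbation functions -/

section Separable

variable {E : Type*} [Fintype E] {h : E → ℝ → EReal}

/-- The traveler's cost as a real number. -/
def realCost (h : E → ℝ → EReal) (c x : EuclideanSpace ℝ E) : ℝ :=
  inner ℝ c x + ∑ e, (h e (x e)).toReal

lemma perturbation_eq_sum (hh : ∀ e, IsLinkPerturbation (h e)) {x : EuclideanSpace ℝ E}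
    (hx : ∀ e, 0 ≤ x e) : perturbation h x = ((∑ e, (h e (x e)).toReal : ℝ) : EReal) := by
  rw [ereal_coe_sum, perturbation]
  exact Finset.sum_congr rfl fun e _ => ((hh e).coe_toReal (hx e)).symm

lemma perturbation_eq_top (hh : ∀ e, IsLinkPerturbation (h e)) {x : EuclideanSpace ℝ E}
    (hx : ¬ ∀ e, 0 ≤ x e) : perturbation h x = ⊤ := by
  classical
  push Not at hx
  obtain ⟨e, he⟩ := hx
  rw [perturbation, ← Finset.add_sum_erase _ _ (Finset.mem_univ e), (hh e).eq_top he]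
  -- In `EReal`, `⊤ + ⊥ = ⊥`, so the other terms must be known not to sum to `⊥`.
  exact EReal.top_add_of_ne_bot (ereal_sum_ne_bot _ _ fun i _ => (hh i).ne_bot _)

lemma cost_eq_realCost (hh : ∀ e, IsLinkPerturbation (h e)) (c : EuclideanSpace ℝ E)
    {x : EuclideanSpace ℝ E} (hx : ∀ e, 0 ≤ x e) : cost h c x = (realCost h c x : EReal) := by
  rw [cost, perturbation_eq_sum hh hx, realCost, EReal.coe_add]

lemma cost_eq_top (hh : ∀ e, IsLinkPerturbation (h e)) (c : EuclideanSpace ℝ E)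
    {x : EuclideanSpace ℝ E} (hx : ¬ ∀ e, 0 ≤ x e) : cost h c x = ⊤ := by
  rw [cost, perturbation_eq_top hh hx, EReal.coe_add_top]

/-- The link-by-link maximizer of `⟨x, y⟩ - H x`. -/
def flow {E : Type*} {h : E → ℝ → EReal} (hh : ∀ e, IsLinkPerturbation (h e))
    (y : EuclideanSpace ℝ E) : EuclideanSpace ℝ E :=
  WithLp.toLp 2 fun e => (hh e).linkFlow (y e)

lemma flow_nonneg {E : Type*} {h : E → ℝ → EReal} (hh : ∀ e, IsLinkPerturbation (h e))
    (y : EuclideanSpace ℝ E) (e : E) :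
    0 ≤ flow hh y e := (hh e).linkFlow_nonneg _

/-- The convex conjugate of the perturbation function as a real number. -/
def realPerturbationConjugate (hh : ∀ e, IsLinkPerturbation (h e))
    (y : EuclideanSpace ℝ E) : ℝ :=
  ∑ e, (hh e).realConjugate (y e)

lemma inner_eq_sum {ι : Type*} [Fintype ι] (x y : EuclideanSpace ℝ ι) :
    inner ℝ x y = ∑ e, x e * y e := by
  simp [PiLp.inner_apply, mul_comm]

lemma inner_sub_le_realPerturbationConjugate (hh : ∀ e, IsLinkPerturbation (h e))
    (y : EuclideanSpace ℝ E) {x : EuclideanSpace ℝ E} (hx : ∀ e, 0 ≤ x e) :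
    inner ℝ x y - ∑ e, (h e (x e)).toReal ≤ realPerturbationConjugate hh y := by
  rw [inner_eq_sum, ← Finset.sum_sub_distrib]
  exact Finset.sum_le_sum fun e _ => (hh e).sub_le_realConjugate _ (hx e)

lemma inner_flow_sub (hh : ∀ e, IsLinkPerturbation (h e)) (y : EuclideanSpace ℝ E) :
    inner ℝ (flow hh y) y - ∑ e, (h e (flow hh y e)).toReal =
      realPerturbationConjugate hh y := by
  rw [inner_eq_sum, ← Finset.sum_sub_distrib]
  rfl

lemma conjugate_perturbation (hh : ∀ e, IsLinkPerturbation (h e)) (y : EuclideanSpace ℝ E) :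
    conjugate (perturbation h) y = (realPerturbationConjugate hh y : EReal) := by
  apply le_antisymm
  · refine iSup_le fun x => ?_
    by_cases hx : ∀ e, 0 ≤ x e
    · rw [perturbation_eq_sum hh hx]
      exact_mod_cast inner_sub_le_realPerturbationConjugate hh y hx
    · simp [perturbation_eq_top hh hx]
  · refine le_iSup_of_le (flow hh y) ?_
    rw [perturbation_eq_sum hh (flow_nonneg hh y)]
    exact_mod_cast (inner_flow_sub hh y).ge

lemma hasGradientAt_realPerturbationConjugate (hh : ∀ e, IsLinkPerturbation (h e))
    (y : EuclideanSpace ℝ E) :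
    HasGradientAt (realPerturbationConjugate hh) (flow hh y) y := by
  rw [hasGradientAt_iff_hasFDerivAt]
  have hlink : ∀ e, HasFDerivAt (fun z : EuclideanSpace ℝ E => (hh e).realConjugate (z e))
      ((hh e).linkFlow (y e) • (EuclideanSpace.proj e : EuclideanSpace ℝ E →L[ℝ] ℝ)) y := fun e =>
    HasDerivAt.comp_hasFDerivAt (h₂ := (hh e).realConjugate) (f := fun z : EuclideanSpace ℝ E => z e)
      y ((hh e).hasDerivAt_realConjugate (y e)) (EuclideanSpace.proj (𝕜 := ℝ) e).hasFDerivAt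
  have hsum : HasFDerivAt (realPerturbationConjugate hh) _ y :=
    HasFDerivAt.fun_sum (u := Finset.univ) fun e _ => hlink e
  refine hsum.congr_fderiv ?_
  ext v
  simp [inner_eq_sum, flow]

lemma hasFiniteGradientAt_conjugate_perturbation (hh : ∀ e, IsLinkPerturbation (h e))
    (y : EuclideanSpace ℝ E) :
    HasFiniteGradientAt (conjugate (perturbation h)) (flow hh y) y := by
  refine ⟨Eventually.of_forall fun z => ?_, ?_⟩
  · rw [conjugate_perturbation hh]
    exact ⟨EReal.coe_ne_bot _, EReal.coe_ne_top _⟩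
  · simp only [conjugate_perturbation hh, EReal.toReal_coe]
    exact hasGradientAt_realPerturbationConjugate hh y

lemma continuousOn_realCost (hh : ∀ e, IsLinkPerturbation (h e)) (c : EuclideanSpace ℝ E) :
    ContinuousOn (realCost h c) {x | ∀ e, 0 ≤ x e} := by
  refine ContinuousOn.add (by fun_prop) (continuousOn_finsetSum _ fun e _ => ?_)
  exact (hh e).continuousOn_toReal.comp (by fun_prop) fun x hx => hx e

/-- The cost of the midpoint of two distinct flows is less than the average of their costs. -/
lemma realCost_midpoint_lt (hh : ∀ e, IsLinkPerturbation (h e)) (c : EuclideanSpace ℝ E)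
    {x z : EuclideanSpace ℝ E} (hx : ∀ e, 0 ≤ x e) (hz : ∀ e, 0 ≤ z e) (hne : x ≠ z) :
    realCost h c ((1 / 2 : ℝ) • x + (1 / 2 : ℝ) • z) <
      1 / 2 * realCost h c x + 1 / 2 * realCost h c z := by
  have hsum : ∑ e, (h e (((1 / 2 : ℝ) • x + (1 / 2 : ℝ) • z) e)).toReal <
      ∑ e, (1 / 2 * (h e (x e)).toReal + 1 / 2 * (h e (z e)).toReal) := by
    have hle : ∀ e, (h e (((1 / 2 : ℝ) • x + (1 / 2 : ℝ) • z) e)).toReal ≤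
        1 / 2 * (h e (x e)).toReal + 1 / 2 * (h e (z e)).toReal := fun e =>
      (hh e).strictConvexOn_toReal.convexOn.2 (hx e) (hz e) (by norm_num) (by norm_num)
        (by norm_num)
    obtain ⟨e, he⟩ : ∃ e, x e ≠ z e := by
      by_contra! hall
      exact hne (PiLp.ext hall)
    refine Finset.sum_lt_sum (fun e _ => hle e) ⟨e, Finset.mem_univ e, ?_⟩
    exact (hh e).strictConvexOn_toReal.2 (hx e) (hz e) he (by norm_num) (by norm_num)
      (by norm_num)
  rw [Finset.sum_add_distrib, ← Finset.mul_sum, ← Finset.mul_sum] at hsum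
  simp only [realCost, inner_add_right, inner_smul_right] at *
  linarith

end Separable

/-! ### Flows in networks -/

lemma Network.incidence_eq {V E : Type*} [DecidableEq V] (G : Network V E) (v : V) (e : E) :
    G.incidence v e = (Pi.single (G.terminal e) 1 : V → ℝ) v -
      (Pi.single (G.initial e) 1 : V → ℝ) v := by
  have hne := G.initial_ne_terminal e
  by_cases h1 : v = G.initial e
  · subst h1
    simp [Network.incidence, hne]
  · by_cases h2 : v = G.terminal e
    · subst h2
      simp [Network.incidence, hne.symm]
    · simp [Network.incidence, h1, h2]

section Flows

variable {V E : Type*} [DecidableEq V] [Fintype E] (G : Network V E)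

lemma Network.incidence_mulVec_single {V E : Type*} [DecidableEq V] [Fintype E] [DecidableEq E]
    (G : Network V E) (e : E) :
    G.incidence.mulVec (Pi.single e 1) =
      Pi.single (G.terminal e) 1 - Pi.single (G.initial e) 1 := by
  ext v
  simp [G.incidence_eq]

/-- Sending one unit along the path works: the contributions of its links telescope. -/
lemma Network.PositivePath.exists_flow {G : Network V E} {v w : V} (hp : G.PositivePath v w) :
    ∃ x : E → ℝ, (∀ e, 0 ≤ x e) ∧
      G.incidence.mulVec x = Pi.single w 1 - Pi.single v 1 := by
  classical
  induction hp with
  | nil => exact ⟨0, fun _ => le_rfl, by simp⟩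
  | snoc e _ ih =>
    obtain ⟨x, hx, hAx⟩ := ih
    refine ⟨x + Pi.single e 1, fun i => add_nonneg (hx i) ?_, ?_⟩
    · exact (Pi.single_nonneg.2 zero_le_one : (0 : E → ℝ) ≤ Pi.single e 1) i
    · rw [Matrix.mulVec_add, hAx, G.incidence_mulVec_single]
      abel

/-- In a strongly connected network there is a circulation with positive flow on every link. -/
lemma Network.StronglyConnected.exists_circulation {G : Network V E} (hG : G.StronglyConnected) :
    ∃ x : E → ℝ, (∀ e, 1 ≤ x e) ∧ G.incidence.mulVec x = 0 := by
  classical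
  have hcycle : ∀ e, ∃ x : E → ℝ, (∀ i, 0 ≤ x i) ∧ 1 ≤ x e ∧ G.incidence.mulVec x = 0 := by
    intro e
    -- A return path from the terminal to the initial node closes `e` into a cycle.
    obtain ⟨x, hx, hAx⟩ := (hG _ _ (G.initial_ne_terminal e).symm).exists_flow
    refine ⟨x + Pi.single e 1, fun i => add_nonneg (hx i) ?_, by simpa using hx e, ?_⟩
    · exact (Pi.single_nonneg.2 zero_le_one : (0 : E → ℝ) ≤ Pi.single e 1) i
    · rw [Matrix.mulVec_add, hAx, G.incidence_mulVec_single]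
      abel
  choose x hx hx1 hAx using hcycle
  refine ⟨∑ e, x e, fun e => ?_, ?_⟩
  · rw [Finset.sum_apply]
    exact (hx1 e).trans (Finset.single_le_sum (f := fun i => x i e) (fun i _ => hx i e)
      (Finset.mem_univ e))
  · rw [Matrix.mulVec_sum]
    exact Finset.sum_eq_zero fun e _ => hAx e

/-- A Slater point: a unit flow from `o` to `d` plus a circulation. The margin 1 leaves room for
perturbations in every direction. -/
lemma exists_conservingFlow_ge_one {G : Network V E} (hG : G.StronglyConnected) {o d : V}
    (hod : o ≠ d) : ∃ x ∈ conservingFlows G o d, ∀ e, 1 ≤ x e := by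
  obtain ⟨x, hx, hAx⟩ := (hG o d hod).exists_flow
  obtain ⟨z, hz, hAz⟩ := hG.exists_circulation
  refine ⟨WithLp.toLp 2 (x + z), ?_, fun e => le_add_of_nonneg_of_le (hx e) (hz e)⟩
  ext v
  have hv : G.incidence.mulVec (x + z) v.1 = demand o d v.1 := by
    rw [Matrix.mulVec_add, hAx, hAz]
    simp only [demand, Pi.add_apply, Pi.sub_apply, Pi.zero_apply, Pi.single_apply, if_neg v.2]
    split_ifs <;> simp
  exact hv

lemma inner_netInflow [Fintype V] (d : V) (u : EuclideanSpace ℝ {v : V // v ≠ d})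
    (x : EuclideanSpace ℝ E) : inner ℝ u (netInflow G d x) = inner ℝ x (tension G d u) := by
  rw [inner_eq_sum, inner_eq_sum]
  change u.ofLp ⬝ᵥ (G.reducedIncidence d).mulVec x.ofLp =
    x.ofLp ⬝ᵥ (G.reducedIncidence d).transpose.mulVec u.ofLp
  rw [Matrix.dotProduct_mulVec, Matrix.mulVec_transpose, dotProduct_comm]

/-- The net inflow as a linear map. -/
def netInflowLin (d : V) : EuclideanSpace ℝ E →ₗ[ℝ] EuclideanSpace ℝ {v : V // v ≠ d} where
  toFun := netInflow G d
  map_add' x y := by simp [netInflow, Matrix.mulVec_add]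
  map_smul' a x := by simp [netInflow, Matrix.mulVec_smul]

/-- The tension as a linear map. -/
def tensionLin [Fintype V] (d : V) :
    EuclideanSpace ℝ {v : V // v ≠ d} →ₗ[ℝ] EuclideanSpace ℝ E where
  toFun := tension G d
  map_add' x y := by simp [tension, Matrix.mulVec_add]
  map_smul' a x := by simp [tension, Matrix.mulVec_smul]

/-- The extension of a potential by zero at the destination. -/
def extendPotential {d : V} (u : EuclideanSpace ℝ {v : V // v ≠ d}) (v : V) : ℝ :=
  if hv : v ≠ d then u ⟨v, hv⟩ else 0

lemma tension_apply {V E : Type*} [Fintype V] [DecidableEq V] (G : Network V E) (d : V)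
    (u : EuclideanSpace ℝ {v : V // v ≠ d}) (e : E) :
    tension G d u e = extendPotential u (G.terminal e) - extendPotential u (G.initial e) := by
  have hsingle : ∀ w : V, ∑ v : {v : V // v ≠ d}, (Pi.single w 1 : V → ℝ) v.1 * u v =
      extendPotential u w := by
    intro w
    by_cases hw : w ≠ d
    · rw [Finset.sum_eq_single ⟨w, hw⟩]
      · simp [extendPotential, hw]
      · intro v _ hv
        have : v.1 ≠ w := fun hvw => hv (Subtype.ext hvw)
        simp [this]
      · simp
    · rw [Finset.sum_eq_zero]
      · simp [extendPotential, hw]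
      · intro v _
        have : v.1 ≠ w := fun hvw => hw (hvw ▸ v.2)
        simp [this]
  change ∑ v : {v : V // v ≠ d}, G.incidence v.1 e * u v = _
  simp only [G.incidence_eq, sub_mul, Finset.sum_sub_distrib, hsingle]

/-- A potential with zero tension is constant along paths, and every node has a path to `d`, where
the extended potential is 0. -/
lemma tensionLin_injective {V E : Type*} [Fintype V] [DecidableEq V] {G : Network V E}
    (hG : G.StronglyConnected) (d : V) :
    Function.Injective (tensionLin G d) := by
  rw [← LinearMap.ker_eq_bot, LinearMap.ker_eq_bot']
  intro u hu
  have hpath : ∀ {v w : V}, G.PositivePath v w → extendPotential u v = extendPotential u w := by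
    intro v w hp
    induction hp with
    | nil => rfl
    | snoc e _ ih =>
      have he : tension G d u e = 0 := congrArg (fun y : EuclideanSpace ℝ E => y e) hu
      rw [tension_apply] at he
      linarith
  ext v
  have := hpath (hG v.1 d v.2)
  simpa [extendPotential, v.2] using this

end Flows

/-! ### The dual function -/

section Duality

variable {V E : Type*} [Fintype V] [DecidableEq V] [Fintype E] (G : Network V E)
  {h : E → ℝ → EReal}

/-- The dual function as a real number. -/
def realDual (hh : ∀ e, IsLinkPerturbation (h e)) (o d : V) (c : EuclideanSpace ℝ E)
    (u : EuclideanSpace ℝ {v : V // v ≠ d}) : ℝ :=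
  inner ℝ u (reducedDemand o d) - realPerturbationConjugate hh (tension G d u - c)

/-- Isolates the expression whose supremum over `x` is `H*(Aᵀu - c)`. -/
lemma realLagrangian_eq (o d : V) (c : EuclideanSpace ℝ E)
    (u : EuclideanSpace ℝ {v : V // v ≠ d}) (x : EuclideanSpace ℝ E) :
    realCost h c x + inner ℝ u (reducedDemand o d - netInflow G d x) =
      inner ℝ u (reducedDemand o d) -
        (inner ℝ x (tension G d u - c) - ∑ e, (h e (x e)).toReal) := by
  rw [inner_sub_right, inner_sub_right, inner_netInflow, realCost, real_inner_comm c x]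
  ring

lemma realDual_le (hh : ∀ e, IsLinkPerturbation (h e)) (o d : V) (c : EuclideanSpace ℝ E)
    (u : EuclideanSpace ℝ {v : V // v ≠ d}) {x : EuclideanSpace ℝ E} (hx : ∀ e, 0 ≤ x e) :
    realDual G hh o d c u ≤
      realCost h c x + inner ℝ u (reducedDemand o d - netInflow G d x) := by
  rw [realLagrangian_eq]
  exact sub_le_sub_left (inner_sub_le_realPerturbationConjugate hh _ hx) _

lemma realDual_eq (hh : ∀ e, IsLinkPerturbation (h e)) (o d : V) (c : EuclideanSpace ℝ E)
    (u : EuclideanSpace ℝ {v : V // v ≠ d}) :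
    realDual G hh o d c u = realCost h c (flow hh (tension G d u - c)) +
      inner ℝ u (reducedDemand o d - netInflow G d (flow hh (tension G d u - c))) := by
  rw [realLagrangian_eq, inner_flow_sub, realDual]

lemma dualFunction_eq (hh : ∀ e, IsLinkPerturbation (h e)) (o d : V) (c : EuclideanSpace ℝ E)
    (u : EuclideanSpace ℝ {v : V // v ≠ d}) :
    dualFunction G h o d c u = (realDual G hh o d c u : EReal) := by
  apply le_antisymm
  · refine iInf_le_of_le (flow hh (tension G d u - c)) ?_
    rw [lagrangian, cost_eq_realCost hh c (flow_nonneg hh _)]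
    exact_mod_cast (realDual_eq G hh o d c u).ge
  · refine le_iInf fun x => ?_
    by_cases hx : ∀ e, 0 ≤ x e
    · rw [lagrangian, cost_eq_realCost hh c hx]
      exact_mod_cast realDual_le G hh o d c u hx
    · rw [lagrangian, cost_eq_top hh c hx, EReal.top_add_coe]
      exact le_top

lemma hasFDerivAt_realDual (hh : ∀ e, IsLinkPerturbation (h e)) (o d : V)
    (c : EuclideanSpace ℝ E) (u : EuclideanSpace ℝ {v : V // v ≠ d}) :
    HasFDerivAt (realDual G hh o d c)
      (innerSL ℝ (reducedDemand o d - netInflow G d (flow hh (tension G d u - c)))) u := by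
  have hT : HasFDerivAt (fun w => tension G d w - c)
      (LinearMap.toContinuousLinearMap (tensionLin G d)) u :=
    (LinearMap.toContinuousLinearMap (tensionLin G d)).hasFDerivAt.sub_const c
  have hc := (hasGradientAt_realPerturbationConjugate hh (tension G d u - c)).hasFDerivAt.comp u hT
  have hb : HasFDerivAt (fun w : EuclideanSpace ℝ {v : V // v ≠ d} =>
      (inner ℝ w (reducedDemand o d) : ℝ)) (innerSL ℝ (reducedDemand o d)) u := by
    refine (innerSL ℝ (reducedDemand o d)).hasFDerivAt.congr_of_eventuallyEq
      (Eventually.of_forall fun w => ?_)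
    exact real_inner_comm _ _
  refine (hb.sub hc).congr_fderiv (ContinuousLinearMap.ext fun w => ?_)
  have hw : inner ℝ (flow hh (tension G d u - c)) (tension G d w) =
      (inner ℝ (netInflow G d (flow hh (tension G d u - c))) w : ℝ) := by
    rw [← inner_netInflow, real_inner_comm]
  simp only [sub_apply, innerSL_apply_apply, inner_sub_left, ← hw]
  rfl

lemma continuous_realDual (hh : ∀ e, IsLinkPerturbation (h e)) (o d : V)
    (c : EuclideanSpace ℝ E) : Continuous (realDual G hh o d c) :=
  continuous_iff_continuousAt.2 fun u => (hasFDerivAt_realDual G hh o d c u).continuousAt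

variable {G}

/-- The flow generated by a maximizer of the dual function conserves flow. -/
lemma flow_mem_conservingFlows (hh : ∀ e, IsLinkPerturbation (h e)) {o d : V}
    {c : EuclideanSpace ℝ E} {u : EuclideanSpace ℝ {v : V // v ≠ d}}
    (hu : ∀ w, realDual G hh o d c w ≤ realDual G hh o d c u) :
    flow hh (tension G d u - c) ∈ conservingFlows G o d := by
  have hmax : IsLocalMax (realDual G hh o d c) u := Eventually.of_forall hu
  have hzero := hmax.hasFDerivAt_eq_zero (hasFDerivAt_realDual G hh o d c u)
  -- Evaluating the zero derivative at the residual itself gives its squared norm.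
  have hself := DFunLike.congr_fun hzero
    (reducedDemand o d - netInflow G d (flow hh (tension G d u - c)))
  rw [innerSL_apply_apply, zero_apply, inner_self_eq_zero] at hself
  exact (sub_eq_zero.1 hself).symm

/-- The dual function is bounded above in terms of the norm of the tension. -/
lemma exists_realDual_le_sub_norm_tension (hG : G.StronglyConnected)
    (hh : ∀ e, IsLinkPerturbation (h e)) {o d : V} (hod : o ≠ d) (c : EuclideanSpace ℝ E) :
    ∃ M : ℝ, ∀ u, realDual G hh o d c u ≤ M - ‖tension G d u‖ := by
  obtain ⟨x, hx, hx1⟩ := exists_conservingFlow_ge_one hG hod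
  have hball : Metric.closedBall x 1 ⊆ {z | ∀ e, 0 ≤ z e} := by
    intro z hz e
    have h1 : |z e - x e| ≤ ‖z - x‖ := PiLp.norm_apply_le (z - x) e
    have h2 : ‖z - x‖ ≤ 1 := mem_closedBall_iff_norm.1 hz
    linarith [neg_abs_le (z e - x e), hx1 e]
  obtain ⟨M, hM⟩ := (isCompact_closedBall x 1).bddAbove_image
    ((continuousOn_realCost hh c).mono hball)
  refine ⟨M, fun u => ?_⟩
  -- Shifting `x` by the unit vector along the tension lowers the Lagrangian's linear term to
  -- `-‖tension G d u‖`, while the cost stays below `M` on the ball. For zero tension, `y = 0`.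
  set y : EuclideanSpace ℝ E := ‖tension G d u‖⁻¹ • tension G d u
  have hy : x + y ∈ Metric.closedBall x 1 := by
    rw [mem_closedBall_iff_norm, add_sub_cancel_left]
    exact mem_closedBall_zero_iff.1 (inv_norm_smul_mem_unitClosedBall _)
  have hsub : reducedDemand o d - netInflow G d (x + y) = -netInflow G d y := by
    have hadd : netInflow G d (x + y) = netInflow G d x + netInflow G d y :=
      map_add (netInflowLin G d) x y
    have hxb : netInflow G d x = reducedDemand o d := hx
    rw [hadd, hxb]
    abel
  have hyT : inner ℝ y (tension G d u) = ‖tension G d u‖ := by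
    rw [real_inner_smul_left, real_inner_self_eq_norm_sq]
    rcases eq_or_ne ‖tension G d u‖ 0 with h0 | h0
    · simp [h0]
    · field_simp
  have hle := realDual_le G hh o d c u (hball hy)
  rw [hsub, inner_neg_right, inner_netInflow, hyT] at hle
  linarith [hM (mem_image_of_mem _ hy)]

lemma exists_forall_realDual_le (hG : G.StronglyConnected)
    (hh : ∀ e, IsLinkPerturbation (h e)) {o d : V} (hod : o ≠ d) (c : EuclideanSpace ℝ E) :
    ∃ u, ∀ w, realDual G hh o d c w ≤ realDual G hh o d c u := by
  obtain ⟨M, hM⟩ := exists_realDual_le_sub_norm_tension hG hh hod c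
  refine (continuous_realDual G hh o d c).exists_forall_ge (tendsto_atBot_mono hM ?_)
  -- An injective linear map from a finite-dimensional space is a closed embedding, so the norm of
  -- the tension tends to infinity with `u`.
  have hcoer : Tendsto (fun u => ‖tension G d u‖) (cocompact _) atTop :=
    (tendsto_norm_cocompact_atTop (E := EuclideanSpace ℝ E)).comp
      (LinearMap.isClosedEmbedding_of_injective
        (LinearMap.ker_eq_bot.2 (tensionLin_injective hG d))).tendsto_cocompact
  simpa only [sub_eq_add_neg, Function.comp_def] using
    tendsto_atBot_add_const_left _ M (tendsto_neg_atTop_atBot.comp hcoer)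

lemma realDual_le_realCost (hh : ∀ e, IsLinkPerturbation (h e)) {o d : V}
    (c : EuclideanSpace ℝ E) (u : EuclideanSpace ℝ {v : V // v ≠ d}) {x : EuclideanSpace ℝ E}
    (hx : ∀ e, 0 ≤ x e) (hxb : x ∈ conservingFlows G o d) :
    realDual G hh o d c u ≤ realCost h c x := by
  have hle := realDual_le G hh o d c u hx
  rwa [show netInflow G d x = reducedDemand o d from hxb, sub_self, inner_zero_right,
    add_zero] at hle

lemma coe_realDual_le_cost (hh : ∀ e, IsLinkPerturbation (h e)) {o d : V}
    (c : EuclideanSpace ℝ E) (u : EuclideanSpace ℝ {v : V // v ≠ d}) {x : EuclideanSpace ℝ E}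
    (hxb : x ∈ conservingFlows G o d) : (realDual G hh o d c u : EReal) ≤ cost h c x := by
  by_cases hx : ∀ e, 0 ≤ x e
  · rw [cost_eq_realCost hh c hx]
    exact_mod_cast realDual_le_realCost hh c u hx hxb
  · rw [cost_eq_top hh c hx]
    exact le_top

/-- There is no duality gap at the flow generated by a maximizer of the dual function. -/
lemma cost_flow_eq_realDual (hh : ∀ e, IsLinkPerturbation (h e)) {o d : V}
    {c : EuclideanSpace ℝ E} {u : EuclideanSpace ℝ {v : V // v ≠ d}}
    (hu : ∀ w, realDual G hh o d c w ≤ realDual G hh o d c u) :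
    cost h c (flow hh (tension G d u - c)) = (realDual G hh o d c u : EReal) := by
  have hmem : netInflow G d _ = reducedDemand o d := flow_mem_conservingFlows hh hu
  rw [cost_eq_realCost hh c (flow_nonneg hh _), realDual_eq, hmem, sub_self, inner_zero_right,
    add_zero]

lemma flow_mem_optimalFlows (hh : ∀ e, IsLinkPerturbation (h e)) {o d : V}
    {c : EuclideanSpace ℝ E} {u : EuclideanSpace ℝ {v : V // v ≠ d}}
    (hu : ∀ w, realDual G hh o d c w ≤ realDual G hh o d c u) :
    flow hh (tension G d u - c) ∈ optimalFlows G h o d c := by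
  refine ⟨flow_mem_conservingFlows hh hu, isMinOn_iff.2 fun x hx => ?_⟩
  rw [cost_flow_eq_realDual hh hu]
  exact coe_realDual_le_cost hh c u hx

lemma optimalFlows_eq_singleton {V E : Type*} [DecidableEq V] [Fintype E] {G : Network V E}
    {h : E → ℝ → EReal} (hh : ∀ e, IsLinkPerturbation (h e)) {o d : V}
    {c x : EuclideanSpace ℝ E} (hx : x ∈ optimalFlows G h o d c) (hx0 : ∀ e, 0 ≤ x e) :
    optimalFlows G h o d c = {x} := by
  refine eq_singleton_iff_unique_mem.2 ⟨hx, fun z hz => ?_⟩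
  by_contra hne
  have hzx := isMinOn_iff.1 hz.2 x hx.1
  have hz0 : ∀ e, 0 ≤ z e := by
    by_contra hz0
    rw [cost_eq_top hh c hz0, cost_eq_realCost hh c hx0] at hzx
    exact absurd hzx (by simp)
  -- The midpoint of two distinct minimizers would be feasible and strictly cheaper.
  have hlt := realCost_midpoint_lt hh c hx0 hz0 (Ne.symm hne)
  have hxb : netInflowLin G d x = reducedDemand o d := hx.1
  have hzb : netInflowLin G d z = reducedDemand o d := hz.1
  have hmb : (1 / 2 : ℝ) • x + (1 / 2 : ℝ) • z ∈ conservingFlows G o d := by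
    change netInflowLin G d _ = _
    rw [map_add, map_smul, map_smul, hxb, hzb, ← add_smul]
    norm_num
  have hm0 : ∀ e, 0 ≤ ((1 / 2 : ℝ) • x + (1 / 2 : ℝ) • z) e := fun e =>
    add_nonneg (mul_nonneg (by norm_num) (hx0 e)) (mul_nonneg (by norm_num) (hz0 e))
  have hxm := isMinOn_iff.1 hx.2 _ hmb
  rw [cost_eq_realCost hh c hx0, cost_eq_realCost hh c hm0, EReal.coe_le_coe_iff] at hxm
  rw [cost_eq_realCost hh c hx0, cost_eq_realCost hh c hz0, EReal.coe_le_coe_iff] at hzx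
  linarith

lemma mem_optimalPotentials_iff (hh : ∀ e, IsLinkPerturbation (h e)) {o d : V}
    {c : EuclideanSpace ℝ E} {u : EuclideanSpace ℝ {v : V // v ≠ d}} :
    u ∈ optimalPotentials G h o d c ↔ ∀ w, realDual G hh o d c w ≤ realDual G hh o d c u := by
  simp [optimalPotentials, isMaxOn_iff, dualFunction_eq G hh]

lemma isClosed_optimalPotentials (hh : ∀ e, IsLinkPerturbation (h e)) (o d : V)
    (c : EuclideanSpace ℝ E) : IsClosed (optimalPotentials G h o d c) := by
  have heq : optimalPotentials G h o d c =
      ⋂ w, {u | realDual G hh o d c w ≤ realDual G hh o d c u} := by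
    ext u
    simp [mem_optimalPotentials_iff hh]
  rw [heq]
  exact isClosed_iInter fun w => isClosed_le continuous_const (continuous_realDual G hh o d c)

end Duality

end PURC

end

theorem mainTheorem4 {V E : Type*} [Fintype V] [DecidableEq V] [Fintype E]
    (G : PURC.Network V E) (hG : G.StronglyConnected)
    (h : E → ℝ → EReal) (hh : ∀ e, PURC.IsLinkPerturbation (h e))
    (o d : V) (hod : o ≠ d) (c : EuclideanSpace ℝ E) :
    -- the primal value is finite, and equals the dual value, which is attained
    (∃ r : ℝ, PURC.primalValue G h o d c = (r : EReal)) ∧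
    PURC.dualValue G h o d c = PURC.primalValue G h o d c ∧
    (∃ u, PURC.dualFunction G h o d c u = PURC.dualValue G h o d c) ∧
    -- the set of optimal potentials is non-empty and closed
    (PURC.optimalPotentials G h o d c).Nonempty ∧
    IsClosed (PURC.optimalPotentials G h o d c) ∧
    -- there is exactly one optimal flow, and every optimal potential gives it
    ∃ x : EuclideanSpace ℝ E, PURC.optimalFlows G h o d c = {x} ∧
      ∀ u ∈ PURC.optimalPotentials G h o d c,
        PURC.HasFiniteGradientAt (PURC.conjugate (PURC.perturbation h)) x
          (PURC.tension G d u - c) ∧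
        ∀ e, PURC.HasFiniteGradientAt (PURC.conjugate (h e)) (x e)
          ((PURC.tension G d u - c) e) := by
  obtain ⟨u, hu⟩ := PURC.exists_forall_realDual_le hG hh hod c
  have hprimal : PURC.primalValue G h o d c = (PURC.realDual G hh o d c u : EReal) := by
    refine le_antisymm ?_ (le_iInf₂ fun x hx => PURC.coe_realDual_le_cost hh c u hx)
    exact (iInf₂_le _ (PURC.flow_mem_conservingFlows hh hu)).trans_eq
      (PURC.cost_flow_eq_realDual hh hu)
  have hdual : PURC.dualValue G h o d c = (PURC.realDual G hh o d c u : EReal) := by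
    refine le_antisymm (iSup_le fun w => ?_) (le_iSup_of_le u ?_)
    · rw [PURC.dualFunction_eq G hh]
      exact_mod_cast hu w
    · rw [PURC.dualFunction_eq G hh]
  have hflows := PURC.optimalFlows_eq_singleton hh (PURC.flow_mem_optimalFlows hh hu)
    (PURC.flow_nonneg hh _)
  refine ⟨⟨_, hprimal⟩, hdual.trans hprimal.symm,
    ⟨u, (PURC.dualFunction_eq G hh o d c u).trans hdual.symm⟩,
    ⟨u, (PURC.mem_optimalPotentials_iff hh).2 hu⟩, PURC.isClosed_optimalPotentials hh o d c,
    _, hflows, fun w hw => ?_⟩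
  -- The flow generated by `w` is also optimal, hence equal to the one generated by `u`.
  have hmem := PURC.flow_mem_optimalFlows hh ((PURC.mem_optimalPotentials_iff hh).1 hw)
  rw [hflows, Set.mem_singleton_iff] at hmem
  rw [← hmem]
  exact ⟨PURC.hasFiniteGradientAt_conjugate_perturbation hh _,
    fun e => (hh e).hasFiniteGradientAt_conjugate _⟩
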